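/- Let $\sigma>0$ be fixed and let $(k_n)$ be a sequence of natural numbers with $k_n\to\infty$. For every $n\ge 1$ suppose that, under probability measures $\mathbb P_\theta=\mathbb P^{(n)}_\theta$ indexed by $\theta=(\theta_1,\theta_2,\dots)\in\ell_2$, we observe an infinite sequence $X=X^{(n)}=(X_1,X_2,\dots)$ of independent random variables with $X_i\sim N(\theta_i,\sigma^2/n)$, and that $\hat\theta^{(n)}=(\hat\theta^{(n)}_1,\hat\theta^{(n)}_2,\dots)$ is an arbitrary random sequence (the initial estimator) that is independent of $X$ under every $\mathbb P_\theta$. For $k\in\mathbb N$ define $$R_{k,n}(\hat\theta^{(n)})=\sum_{i=1}^{k}(X_i-\hat\theta^{(n)}_i)^2-\frac{k\sigma^2}{n},\qquad \hat\tau^2_{k,n,\theta}=\frac{2k\sigma^4}{n^2}+\frac{4\sigma^2}{n}\sum_{i=1}^{k}(\theta_i-\hat\theta^{(n)}_i)^2 .$$ Let $\Phi$ be the standard normal distribution function. **Theorem 3.1.** As $n\to\infty$, $$\sup_{\theta\in\ell_2}\ \sup_{x\in\mathbb R}\left|\mathbb P_\theta\left(\frac{R_{k_n,n}(\hat\theta^{(n)})-\sum_{i=1}^{k_n}(\theta_i-\hat\theta^{(n)}_i)^2}{\hat\tau_{k_n,n,\theta}}\le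 x\ \Big|\ \hat\theta^{(n)}\right)-\Phi(x)\right|\longrightarrow 0$$ almost surely, and in fact uniformly in the values of $\hat\theta^{(n)}$. Precisely: 1. For any regular conditional distributions given $\hat\theta^{(n)}$, the $\mathbb P_\theta$-essential supremum of $\sup_{x}|\mathbb P_\theta(\cdots\le x\mid\hat\theta^{(n)})-\Phi(x)|$ tends to $0$, uniformly in $\theta\in\ell_2$. 2. For $t\in\mathbb R^{\mathbb N}$ let $G_{n,\theta}(t,\cdot)$ be the distribution function under $\mathbb P_\theta$ of the standardized statistic above with $\hat\theta^{(n)}$ replaced everywhere by the fixed (nonrandom) sequence $t=(t_1,t_2,\dots)$. Then for every $n\ge1$ and $\theta\in\ell_2$, $G_{n,\theta}(\hat\theta^{(n)},\cdot)$ is a version of the conditional distribution function of the standardized statistic given $\hat\theta^{(n)}$ under $\mathbb P_\theta$, and $$\sup_{\theta\in\ell_2}\ \sup_{t\in\mathbb R^{\mathbb N}}\ \sup_{x\in\mathbb R}\left|G_{n,\theta}(t,x)-\Phi(x)\right|\longrightarrow 0 .$$ -/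

import Mathlib

open MeasureTheory ProbabilityTheory Filter Topology
open scoped ENNReal NNReal

noncomputable section

namespace GaussianSequence

/-- The space `ℓ₂` of square-summable real sequences. Coordinates are indexed by `ℕ`, so the
coordinates written `1, …, k` in the usual notation are the indices in `Finset.range k`. -/
abbrev EllTwo : Type := lp (fun _ : ℕ => ℝ) 2

/-- The Gaussian sequence model at noise level `n`, together with an initial estimator.
Under `P θ` the observations `X 0, X 1, …` are independent, `X i` has the normal distribution with
mean `θ i` and variance `σ² / n`, and the initial estimator `θhat`, an arbitrary random sequence, is
independent of the whole sequence of observations. The random variables themselves do not depend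
on the parameter `θ`. -/
structure IsModel {Ω : Type*} [MeasurableSpace Ω] (σ : ℝ) (n : ℕ)
    (P : EllTwo → Measure Ω) (X : ℕ → Ω → ℝ) (θhat : Ω → ℕ → ℝ) : Prop where
  measurable_obs : ∀ i, Measurable (X i)
  measurable_init : Measurable θhat
  indep_obs : ∀ θ, iIndepFun X (P θ)
  law_obs : ∀ θ i, (P θ).map (X i) = gaussianReal (θ i) (σ ^ 2 / n).toNNReal
  indep_init : ∀ θ, IndepFun θhat (fun ω i => X i ω) (P θ)

/-- `∑_{i ≤ k} (θ_i - t_i)²`. -/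
def projDistSq (k : ℕ) (θ t : ℕ → ℝ) : ℝ :=
  ∑ i ∈ Finset.range k, (θ i - t i) ^ 2

/-- The statistic `R_{k,n}(t) = ∑_{i ≤ k} (x_i - t_i)² - k σ² / n`, for data `x` and center `t`. -/
def R (σ : ℝ) (k n : ℕ) (x t : ℕ → ℝ) : ℝ :=
  ∑ i ∈ Finset.range k, (x i - t i) ^ 2 - k * σ ^ 2 / n

/-- The variance `τ² = 2 k σ⁴ / n² + (4 σ² / n) ∑_{i ≤ k} (θ_i - t_i)²`. -/
def tauSq (σ : ℝ) (k n : ℕ) (θ t : ℕ → ℝ) : ℝ :=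
  2 * k * σ ^ 4 / (n : ℝ) ^ 2 + 4 * σ ^ 2 / n * projDistSq k θ t

/-- The standardized statistic `(R_{k,n}(t) - ∑_{i ≤ k} (θ_i - t_i)²) / τ`. -/
def standardized (σ : ℝ) (k n : ℕ) (θ x t : ℕ → ℝ) : ℝ :=
  (R σ k n x t - projDistSq k θ t) / √(tauSq σ k n θ t)

/-- The standardized statistic as a random variable, with the initial estimator as the center. -/
def stat {Ω : Type*} (σ : ℝ) (k n : ℕ) (θ : EllTwo) (X : ℕ → Ω → ℝ) (θhat : Ω → ℕ → ℝ)
    (ω : Ω) : ℝ :=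
  standardized σ k n (fun i => θ i) (fun i => X i ω) (θhat ω)

/-- The law, under `μ`, of the standardized statistic when the value of the initial estimator is
held fixed at `t` and only the observations are random. -/
def fixedCenterLaw {Ω : Type*} [MeasurableSpace Ω] (σ : ℝ) (k n : ℕ) (θ : EllTwo)
    (X : ℕ → Ω → ℝ) (μ : Measure Ω) (t : ℕ → ℝ) : Measure ℝ :=
  μ.map (fun ω => standardized σ k n (fun i => θ i) (fun i => X i ω) t)

/-- The Kolmogorov distance `sup_x |ν (-∞, x] - Φ(x)|` of `ν` to the standard normal distribution,
as an extended nonnegative number. -/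
def kolmogorovToNormal (ν : Measure ℝ) : ℝ≥0∞ :=
  ⨆ x : ℝ, ENNReal.ofReal |ν.real (Set.Iic x) - cdf (gaussianReal 0 1) x|

end GaussianSequence

end

/-! In units of the noise level `σ / √n`, the statistic with fixed center `t` is a normalized sum of
independent terms `Z_i² - 1 + 2 a_i Z_i`, with `Z_i` standard normal and `a_i = (θ_i - t_i) / (σ /
√n)`. Its characteristic function is explicit and involves `θ` and `t` only through `A = ∑ a_i²`
(`charFun_fixedCenterLaw`). After division by `√(2k + 4A)` its logarithm differs from `-s²/2` by at
most a multiple of `|s|³ / √(2k + 4A)`, which vanishes as `k → ∞` whatever `A` is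
(`tendsto_exp_logCharFun`).

So normality holds along every choice of `(θ_n, t_n)`, which amounts to uniformity in `(θ, t)`;
Lévy's and Pólya's theorems supply uniformity in `x`. By independence, the conditional law given the
initial estimator is the fixed-center law at its value, so the conditional claim follows. -/

/-! ### Uniform convergence: selections and Pólya's theorem -/

/-- A family of suprema tends to zero as soon as it does so along every selection of indices. -/
lemma ENNReal.tendsto_iSup_zero_of_forall_selection {S : Type*} [Nonempty S] {f : ℕ → S → ℝ≥0∞}
    (h : ∀ s : ℕ → S, Tendsto (fun n => f n (s n)) atTop (𝓝 0)) :
    Tendsto (fun n => ⨆ s, f n s) atTop (𝓝 0) := by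
  rw [ENNReal.tendsto_nhds_zero]
  intro ε hε
  -- The selection picks an index violating the bound `ε` whenever one exists.
  have hsel : ∀ n, ∃ s, (∃ s', ε < f n s') → ε < f n s := fun n => by
    by_cases hn : ∃ s', ε < f n s'
    · exact ⟨hn.choose, fun _ => hn.choose_spec⟩
    · exact ⟨Classical.arbitrary S, fun h' => absurd h' hn⟩
  choose s hs using hsel
  filter_upwards [ENNReal.tendsto_nhds_zero.1 (h s) ε hε] with n hn
  refine iSup_le fun s' => ?_
  by_contra! hlt
  exact absurd (hs n ⟨s', hlt⟩) (not_lt.2 hn)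

/-- The distribution function of a probability measure without atoms is continuous. -/
lemma ProbabilityTheory.continuous_cdf (ν : Measure ℝ) [IsProbabilityMeasure ν]
    [NullSingletonClass ν] : Continuous (cdf ν) := by
  rw [continuous_iff_continuousAt]
  intro x
  rw [(monotone_cdf ν).continuousAt_iff_leftLim_eq_rightLim, (cdf ν).rightLim_eq]
  have h := (cdf ν).measure_singleton x
  rw [measure_cdf, measure_singleton] at h
  exact le_antisymm ((monotone_cdf ν).leftLim_le le_rfl)
    (sub_nonpos.1 (ENNReal.ofReal_eq_zero.1 h.symm))

/-- **Pólya's theorem**: weak convergence to a limit without atoms implies uniform convergence of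
the distribution functions. -/
theorem MeasureTheory.ProbabilityMeasure.eventually_forall_abs_real_Iic_sub_cdf_le
    {ι : Type*} {L : Filter ι} {μ : ι → ProbabilityMeasure ℝ} {ν : ProbabilityMeasure ℝ}
    [NullSingletonClass (ν : Measure ℝ)] (h : Tendsto μ L (𝓝 ν)) {ε : ℝ} (hε : 0 < ε) :
    ∀ᶠ i in L, ∀ x, |(μ i : Measure ℝ).real (Set.Iic x) - cdf (ν : Measure ℝ) x| ≤ ε := by
  set F := cdf (ν : Measure ℝ) with hF
  have hpt : ∀ x, Tendsto (fun i => (μ i : Measure ℝ).real (Set.Iic x)) L (𝓝 (F x)) := fun x => by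
    have hx := ProbabilityMeasure.tendsto_measure_of_null_frontier_of_tendsto' h
      (E := Set.Iic x) (by simp)
    rw [hF, cdf_eq_real]
    exact (ENNReal.tendsto_toReal (measure_ne_top _ _)).comp hx
  -- Quantile grid of mesh `1 / N`. The lower bound loses three meshes: one for convergence at a
  -- grid point, two because `F x` may be nearly `(j + 1) / N` while comparison is with `y (j - 1)`.
  obtain ⟨N, hN⟩ := exists_nat_gt (3 / ε)
  have hN0 : (0 : ℝ) < N := lt_trans (by positivity) hN
  have hNε : 3 / N ≤ ε := by
    rw [div_lt_iff₀ hε] at hN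
    rw [div_le_iff₀ hN0]
    linarith
  have hgrid : ∀ j : ℕ, ∃ y, 0 < j → j < N → F y = j / N := fun j => by
    by_cases hj : 0 < j ∧ j < N
    · have h0 : (0 : ℝ) < j / N := div_pos (by exact_mod_cast hj.1) hN0
      have h1 : (j : ℝ) / N < 1 := (div_lt_one hN0).2 (by exact_mod_cast hj.2)
      obtain ⟨y, hy⟩ := mem_range_of_exists_le_of_exists_ge (continuous_cdf (ν : Measure ℝ))
        (((tendsto_cdf_atBot (ν : Measure ℝ)).eventually_lt_const h0).exists.imp fun _ => le_of_lt)
        (((tendsto_cdf_atTop (ν : Measure ℝ)).eventually_const_lt h1).exists.imp fun _ => le_of_lt)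
      exact ⟨y, fun _ _ => hy⟩
    · exact ⟨0, fun h0 h1 => absurd ⟨h0, h1⟩ hj⟩
  choose y hy using hgrid
  have hev : ∀ᶠ i in L, ∀ j ∈ Finset.range N,
      |(μ i : Measure ℝ).real (Set.Iic (y j)) - F (y j)| < 1 / N := by
    rw [eventually_all_finset]
    intro j _
    have := (hpt (y j)).eventually (Metric.ball_mem_nhds _ (one_div_pos.2 hN0))
    simpa [Real.dist_eq] using this
  filter_upwards [hev] with i hi x
  have hmono : ∀ {a b : ℝ}, a ≤ b →
      (μ i : Measure ℝ).real (Set.Iic a) ≤ (μ i : Measure ℝ).real (Set.Iic b) :=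
    fun hab => measureReal_mono (Set.Iic_subset_Iic.2 hab)
  set j := ⌊N * F x⌋₊ with hj
  have hFx0 : 0 ≤ F x := cdf_nonneg _ x
  have hFx1 : F x ≤ 1 := cdf_le_one _ x
  have hj1 : (j : ℝ) / N ≤ F x := by
    rw [div_le_iff₀ hN0, mul_comm]
    exact Nat.floor_le (by positivity)
  have hj2 : F x < (j + 1) / N := by
    rw [lt_div_iff₀ hN0, mul_comm]
    exact Nat.lt_floor_add_one _
  have hjN : j ≤ N := by
    have : (j : ℝ) ≤ N := by
      rw [div_le_iff₀ hN0] at hj1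
      nlinarith
    exact_mod_cast this
  have hsplit : ∀ c : ℝ, (c + 1) / N = c / N + 1 / N := fun c => by ring
  rw [hsplit] at hj2
  have h3 : (3 : ℝ) / N = 3 * (1 / N) := by ring
  have hpos : 0 < 1 / (N : ℝ) := by positivity
  rw [abs_le]
  constructor
  · by_cases hj' : 2 ≤ j
    · have e : F (y (j - 1)) = (j : ℝ) / N - 1 / N := by
        rw [hy (j - 1) (by omega) (by omega), Nat.cast_sub (by omega)]
        push_cast
        ring
      -- `y j ≤ x` can fail if `F` is flat at level `j / N`; one grid step back the inequality of
      -- `F`-values is strict.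
      have hle : y (j - 1) ≤ x := by
        by_contra! hlt
        have := monotone_cdf (ν : Measure ℝ) hlt.le
        rw [← hF, e] at this
        linarith
      have h' := abs_lt.1 (hi (j - 1) (Finset.mem_range.2 (by omega)))
      have := hmono hle
      linarith
    · have : (j : ℝ) / N ≤ 1 / N := by
        gcongr
        exact_mod_cast (by omega : j ≤ 1)
      have := measureReal_nonneg (μ := (μ i : Measure ℝ)) (s := Set.Iic x)
      linarith
  · by_cases hj' : j + 1 < N
    · have e : F (y (j + 1)) = (j : ℝ) / N + 1 / N := by
        rw [hy (j + 1) (by omega) hj']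
        push_cast
        ring
      have hle : x ≤ y (j + 1) := by
        by_contra! hlt
        have := monotone_cdf (ν : Measure ℝ) hlt.le
        rw [← hF, e] at this
        linarith
      have h' := abs_lt.1 (hi (j + 1) (Finset.mem_range.2 hj'))
      have := hmono hle
      linarith
    · have : 1 ≤ (j : ℝ) / N + 1 / N := by
        rw [← hsplit, one_le_div hN0]
        exact_mod_cast (by omega : N ≤ j + 1)
      have := measureReal_le_one (μ := (μ i : Measure ℝ)) (s := Set.Iic x)
      linarith

/-! ### Conditional laws under independence -/

/-- If `T` and `Y` are independent, then the conditional law of `g (T, Y)` given `T` is the law of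
`g (t, Y)` at `t = T`. -/
lemma ProbabilityTheory.IndepFun.condDistrib_ae_eq_map {Ω α β γ : Type*} [MeasurableSpace Ω]
    [MeasurableSpace α] [MeasurableSpace β] [MeasurableSpace γ] [StandardBorelSpace γ] [Nonempty γ]
    {μ : Measure Ω} [IsProbabilityMeasure μ] {T : Ω → α} {Y : Ω → β} {g : α × β → γ}
    (hTY : IndepFun T Y μ) (hT : Measurable T) (hY : Measurable Y) (hg : Measurable g) :
    ∀ᵐ ω ∂μ, condDistrib (fun ω => g (T ω, Y ω)) T μ (T ω) = μ.map (fun ω' => g (T ω, Y ω')) := by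
  have : IsProbabilityMeasure (μ.map Y) := Measure.isProbabilityMeasure_map hY.aemeasurable
  have : IsProbabilityMeasure (μ.map T) := Measure.isProbabilityMeasure_map hT.aemeasurable
  let κ : Kernel α γ := (Kernel.id ×ₖ Kernel.const α (μ.map Y)).map g
  have hκ : ∀ t, κ t = μ.map (fun ω' => g (t, Y ω')) := fun t => by
    rw [Kernel.map_apply _ hg, Kernel.prod_apply, Kernel.id_apply, Kernel.const_apply,
      Measure.dirac_prod, Measure.map_map hg (by fun_prop),
      Measure.map_map (by fun_prop) hY]
    rfl
  have : IsMarkovKernel κ := Kernel.IsMarkovKernel.map _ hg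
  -- By Fubini `κ` disintegrates the joint law; conditional laws are a.e. unique.
  have hjoint : μ.map (fun ω => (T ω, g (T ω, Y ω))) = μ.map T ⊗ₘ κ := by
    have e : (fun ω => (T ω, g (T ω, Y ω))) = (fun p : α × β => (p.1, g p)) ∘ fun ω => (T ω, Y ω) :=
      rfl
    rw [e, ← Measure.map_map (by fun_prop) (by fun_prop),
      hTY.map_prod_eq_prod_map_map hT.aemeasurable hY.aemeasurable]
    ext s hs
    rw [Measure.map_apply (by fun_prop) hs, Measure.prod_apply (hs.preimage (by fun_prop)),
      Measure.compProd_apply hs]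
    refine lintegral_congr fun t => ?_
    rw [hκ, Measure.map_apply (by fun_prop) (hs.preimage (by fun_prop)),
      Measure.map_apply hY (measurable_prodMk_left (hs.preimage (by fun_prop)))]
    rfl
  have := condDistrib_ae_eq_of_measure_eq_compProd_of_measurable hT (by fun_prop) hjoint
  filter_upwards [ae_of_ae_map hT.aemeasurable this] with ω hω
  rw [hω, hκ]

/-! ### Characteristic function of the quadratic form -/

namespace GaussianSequence

/-- The logarithm of the characteristic function at `u` of `∑ i, ((Z i) ^ 2 - 1 + 2 * a i * Z i)`
for `K` independent standard normal `Z i`, where `A = ∑ i, (a i) ^ 2`. -/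
noncomputable def logCharFun (K A u : ℝ) : ℂ :=
  K * (-(1 / 2) * Complex.log (1 + -2 * u * Complex.I) - u * Complex.I) -
    2 * A * u ^ 2 / (1 + -2 * u * Complex.I)

lemma one_add_neg_two_mul_I_ne_zero (u : ℝ) : 1 + -2 * u * Complex.I ≠ 0 := by
  intro h
  simpa using congrArg Complex.re h

lemma logCharFun_add (K A K' A' u : ℝ) :
    logCharFun (K + K') (A + A') u = logCharFun K A u + logCharFun K' A' u := by
  unfold logCharFun
  push_cast
  ring

lemma prod_exp_logCharFun (k : ℕ) (a : ℕ → ℝ) (u : ℝ) :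
    ∏ i ∈ Finset.range k, Complex.exp (logCharFun 1 (a i ^ 2) u) =
      Complex.exp (logCharFun k (∑ i ∈ Finset.range k, a i ^ 2) u) := by
  induction k with
  | zero => simp [logCharFun]
  | succ k ih =>
    rw [Finset.prod_range_succ, ih, Finset.sum_range_succ, Nat.cast_succ, logCharFun_add,
      Complex.exp_add]

/-- The integrand is a Gaussian exponential with leading coefficient `-w / 2`, where `w = 1 - 2iu`.
Since `Re w = 1`, the integral converges and the principal branch of `log w` applies. -/
lemma charFun_map_gaussianReal_quadratic (a u : ℝ) :
    charFun ((gaussianReal 0 1).map fun z => z ^ 2 - 1 + 2 * a * z) u =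
      Complex.exp (logCharFun 1 (a ^ 2) u) := by
  set w : ℂ := 1 + -2 * u * Complex.I with hw
  have hw0 : w ≠ 0 := one_add_neg_two_mul_I_ne_zero u
  have hwre : w.re = 1 := by simp [hw]
  rw [charFun_apply_real, integral_map (by fun_prop)
    (by fun_prop), integral_gaussianReal_eq_integral_smul one_ne_zero]
  have hint : ∀ z : ℝ, gaussianPDFReal 0 1 z •
      Complex.exp (u * ((z ^ 2 - 1 + 2 * a * z : ℝ) : ℂ) * Complex.I) =
      ((√(2 * Real.pi))⁻¹ : ℝ) *
        Complex.exp (-(w / 2) * z ^ 2 + 2 * a * u * Complex.I * z + -(u * Complex.I)) := fun z => by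
    rw [gaussianPDFReal, Complex.real_smul]
    push_cast
    rw [mul_assoc, ← Complex.exp_add]
    simp only [mul_one]
    congr 2
    rw [hw]
    ring
  simp_rw [hint]
  rw [integral_const_mul, integral_cexp_quadratic (by simp [hwre]), neg_neg]
  have hpow : ((√(2 * Real.pi))⁻¹ : ℝ) * (Real.pi / (w / 2)) ^ (1 / 2 : ℂ) =
      Complex.exp (-(1 / 2) * Complex.log w) := by
    have e : (Real.pi : ℂ) / (w / 2) = ((2 * Real.pi : ℝ) : ℂ) * w⁻¹ := by
      push_cast
      field_simp
    have harg : w.arg ≠ Real.pi := by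
      intro h
      have := (Complex.arg_eq_pi_iff.1 h).1
      rw [hwre] at this
      linarith
    have hpos : 0 < 2 * Real.pi := by positivity
    rw [e, Complex.cpow_def_of_ne_zero (mul_ne_zero (by exact_mod_cast hpos.ne') (inv_ne_zero hw0)),
      Complex.log_ofReal_mul hpos (inv_ne_zero hw0), Complex.log_inv _ harg, Real.sqrt_eq_rpow,
      Real.rpow_def_of_pos hpos, ← Real.exp_neg, Complex.ofReal_exp, ← Complex.exp_add]
    congr 1
    push_cast
    ring
  rw [← mul_assoc, hpow, ← Complex.exp_add, logCharFun, ← hw]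
  congr 1
  push_cast
  field_simp
  linear_combination (16 * a ^ 2 * u ^ 2 : ℂ) * Complex.I_sq

/-- Taylor expansion of `log (1 + z)` at `z = -2iu`: the linear terms cancel. The cubic remainders
have coefficients `8/3` for `K` and `4` for `A`, within `3` and `6`. An error proportional to `K +
2A` is what gives uniformity in `A`. -/
lemma norm_logCharFun_add_le {K A u : ℝ} (hK : 0 ≤ K) (hA : 0 ≤ A) (hu : |u| ≤ 1 / 4) :
    ‖logCharFun K A u + (K + 2 * A) * u ^ 2‖ ≤ 3 * (K + 2 * A) * |u| ^ 3 := by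
  set z : ℂ := -2 * u * Complex.I with hz
  have hznorm : ‖z‖ = 2 * |u| := by simp [hz]
  have hz0 : 1 + z ≠ 0 := one_add_neg_two_mul_I_ne_zero u
  have hlog := Complex.norm_log_sub_logTaylor_le 2 (z := z) (by rw [hznorm]; linarith)
  have hlogT : ‖Complex.log (1 + z) - (z - z ^ 2 / 2)‖ ≤ 16 / 3 * |u| ^ 3 := by
    have e : Complex.logTaylor 3 z = z - z ^ 2 / 2 := by
      simp [Complex.logTaylor, Finset.sum_range_succ]
      ring
    norm_num at hlog
    rw [e, hznorm] at hlog
    refine hlog.trans ?_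
    have : (1 - 2 * |u|)⁻¹ ≤ 2 := by
      rw [inv_le_comm₀ (by linarith) (by norm_num)]
      linarith
    calc (2 * |u|) ^ 3 * (1 - 2 * |u|)⁻¹ / 3 ≤ (2 * |u|) ^ 3 * 2 / 3 := by gcongr
      _ = 16 / 3 * |u| ^ 3 := by ring
  have hnorm1 : 1 ≤ ‖1 + z‖ := by
    have := Complex.abs_re_le_norm (1 + z)
    simpa [hz] using this
  have e : logCharFun K A u + (K + 2 * A) * u ^ 2 =
      -(K / 2) * (Complex.log (1 + z) - (z - z ^ 2 / 2)) + 2 * A * u ^ 2 * (z / (1 + z)) := by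
    rw [logCharFun, ← hz]
    field_simp
    rw [hz]
    linear_combination (4 * K * u ^ 2 * (1 + -2 * u * Complex.I) : ℂ) * Complex.I_sq
  rw [e]
  have h2 : ‖z / (1 + z)‖ ≤ 2 * |u| := by
    rw [norm_div, hznorm]
    exact div_le_self (by positivity) hnorm1
  refine (norm_add_le _ _).trans ?_
  rw [norm_mul, norm_mul]
  have n1 : ‖-((K : ℂ) / 2)‖ = K / 2 := by simp [abs_of_nonneg hK]
  have n2 : ‖2 * (A : ℂ) * u ^ 2‖ = 2 * A * |u| ^ 2 := by simp [abs_of_nonneg hA]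
  rw [n1, n2]
  calc _ ≤ K / 2 * (16 / 3 * |u| ^ 3) + 2 * A * |u| ^ 2 * (2 * |u|) := by gcongr
    _ ≤ 3 * (K + 2 * A) * |u| ^ 3 := by
      have h3 : 0 ≤ |u| ^ 3 := by positivity
      nlinarith [mul_nonneg hK h3, mul_nonneg hA h3]

lemma tendsto_exp_logCharFun {K A : ℕ → ℝ} (hK : Tendsto K atTop atTop) (hA : ∀ n, 0 ≤ A n)
    (s : ℝ) :
    Tendsto (fun n => Complex.exp (logCharFun (K n) (A n) (s / √(2 * K n + 4 * A n)))) atTop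
      (𝓝 (Complex.exp (-(s ^ 2 / 2)))) := by
  refine (Complex.continuous_exp.tendsto _).comp ?_
  set v : ℕ → ℝ := fun n => √(2 * K n + 4 * A n) with hv
  have hvtop : Tendsto v atTop atTop := by
    refine Real.tendsto_sqrt_atTop.comp (tendsto_atTop_mono' _ ?_ hK)
    filter_upwards [hK.eventually_ge_atTop 0] with n hn
    linarith [hA n]
  have hu : Tendsto (fun n => |s / v n|) atTop (𝓝 0) := by
    simpa using (tendsto_const_nhds.div_atTop hvtop : Tendsto (fun n => s / v n) atTop (𝓝 0)).abs
  rw [tendsto_iff_norm_sub_tendsto_zero]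
  have hlim : Tendsto (fun n => 3 / 2 * s ^ 2 * |s / v n|) atTop (𝓝 0) := by
    simpa using hu.const_mul (3 / 2 * s ^ 2)
  refine squeeze_zero' (.of_forall fun _ => norm_nonneg _) ?_ hlim
  filter_upwards [hu.eventually_le_const (by norm_num : (0 : ℝ) < 1 / 4),
    hK.eventually_gt_atTop 0] with n hn hKn
  have hpos : 0 < 2 * K n + 4 * A n := by linarith [hA n]
  -- The normalization makes the quadratic term exactly `s² / 2`, leaving one spare factor `|s / v
  -- n|` in the cubic error.
  have hsq : (K n + 2 * A n) * (s / v n) ^ 2 = s ^ 2 / 2 := by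
    rw [div_pow, hv, Real.sq_sqrt hpos.le]
    have := hA n
    field_simp
    ring
  have hb := norm_logCharFun_add_le hKn.le (hA n) hn
  have e1 : ((K n : ℂ) + 2 * A n) * ((s / v n : ℝ) : ℂ) ^ 2 = (s : ℂ) ^ 2 / 2 := by
    exact_mod_cast congrArg (Complex.ofReal) hsq
  have e2 : 3 * (K n + 2 * A n) * |s / v n| ^ 3 = 3 / 2 * s ^ 2 * |s / v n| := by
    rw [pow_succ, sq_abs]
    linear_combination 3 * |s / v n| * hsq
  rw [e1, e2] at hb
  simpa [sub_neg_eq_add] using hb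

end GaussianSequence

/-! ### Reduction of the model to the quadratic form -/

namespace GaussianSequence

/-- With `δ = σ / √n`, expanding `(x_i - t_i)²` around `θ_i` puts a factor `δ²` in both numerator
and `τ`, and it cancels. -/
lemma standardized_eq {σ : ℝ} (hσ : 0 < σ) {n : ℕ} (hn : 1 ≤ n) (k : ℕ) (θ x t : ℕ → ℝ) :
    standardized σ k n θ x t =
      (√(2 * k + 4 * ∑ i ∈ Finset.range k, ((θ i - t i) / (σ / √n)) ^ 2))⁻¹ *
        ∑ i ∈ Finset.range k, (((x i - θ i) / (σ / √n)) ^ 2 - 1 +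
          2 * ((θ i - t i) / (σ / √n)) * ((x i - θ i) / (σ / √n))) := by
  have hn0 : (0 : ℝ) < n := by exact_mod_cast hn
  set δ := σ / √n with hδ
  have hδ0 : 0 < δ := by positivity
  have hδ2 : σ ^ 2 / n = δ ^ 2 := by rw [hδ, div_pow, Real.sq_sqrt hn0.le]
  have hproj : projDistSq k θ t = δ ^ 2 * ∑ i ∈ Finset.range k, ((θ i - t i) / δ) ^ 2 := by
    rw [projDistSq, Finset.mul_sum]
    refine Finset.sum_congr rfl fun i _ => ?_
    field_simp
  have hnum : R σ k n x t - projDistSq k θ t = δ ^ 2 * ∑ i ∈ Finset.range k,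
      (((x i - θ i) / δ) ^ 2 - 1 + 2 * ((θ i - t i) / δ) * ((x i - θ i) / δ)) := by
    have hk : (k : ℝ) * σ ^ 2 / n = ∑ i ∈ Finset.range k, δ ^ 2 := by
      rw [Finset.sum_const, Finset.card_range, nsmul_eq_mul, ← hδ2]
      ring
    rw [R, projDistSq, hk, ← Finset.sum_sub_distrib, ← Finset.sum_sub_distrib, Finset.mul_sum]
    refine Finset.sum_congr rfl fun i _ => ?_
    field_simp
    ring
  have htau : tauSq σ k n θ t =
      (δ ^ 2) ^ 2 * (2 * k + 4 * ∑ i ∈ Finset.range k, ((θ i - t i) / δ) ^ 2) := by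
    have h4 : 2 * k * σ ^ 4 / (n : ℝ) ^ 2 = 2 * k * (σ ^ 2 / n) ^ 2 := by ring
    have h2 : 4 * σ ^ 2 / n = 4 * (σ ^ 2 / n) := by ring
    rw [tauSq, h4, h2, hδ2, hproj]
    ring
  rw [standardized, hnum, htau, Real.sqrt_mul (by positivity), Real.sqrt_sq (by positivity),
    mul_div_mul_left _ _ (by positivity), div_eq_inv_mul]

@[fun_prop]
lemma measurable_standardized {Ω : Type*} [MeasurableSpace Ω] (σ : ℝ) (k n : ℕ) (θ : ℕ → ℝ)
    {x t : Ω → ℕ → ℝ} (hx : Measurable x) (ht : Measurable t) :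
    Measurable fun ω => standardized σ k n θ (x ω) (t ω) := by
  unfold standardized R tauSq projDistSq
  fun_prop

variable {Ω : Type*} [MeasurableSpace Ω] {σ : ℝ} {n : ℕ} {P : EllTwo → Measure Ω}
  {X : ℕ → Ω → ℝ} {θhat : Ω → ℕ → ℝ}

lemma IsModel.measurable_pi_obs (h : IsModel σ n P X θhat) : Measurable fun ω i => X i ω :=
  measurable_pi_lambda _ h.measurable_obs

lemma IsModel.isProbabilityMeasure_fixedCenterLaw (h : IsModel σ n P X θhat) (k : ℕ) (θ : EllTwo)
    [IsProbabilityMeasure (P θ)] (t : ℕ → ℝ) :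
    IsProbabilityMeasure (fixedCenterLaw σ k n θ X (P θ) t) :=
  Measure.isProbabilityMeasure_map
    (measurable_standardized σ k n _ h.measurable_pi_obs measurable_const).aemeasurable

lemma IsModel.map_standardize_obs (h : IsModel σ n P X θhat) (hσ : 0 < σ) (hn : 1 ≤ n)
    (θ : EllTwo) (i : ℕ) :
    (P θ).map (fun ω => (X i ω - θ i) / (σ / √n)) = gaussianReal 0 1 := by
  have hn0 : (0 : ℝ) < n := by exact_mod_cast hn
  have e : (fun ω => (X i ω - θ i) / (σ / √n)) = (fun x => (x - θ i) / (σ / √n)) ∘ X i := rfl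
  have e' : (fun x => (x - θ i) / (σ / √n)) = (fun x => x / (σ / √n)) ∘ fun x => x - θ i := rfl
  rw [e, ← Measure.map_map (by fun_prop) (h.measurable_obs i), h.law_obs, e',
    ← Measure.map_map (by fun_prop) (by fun_prop), gaussianReal_map_sub_const,
    gaussianReal_map_div_const, sub_self, zero_div]
  congr 1
  ext
  have : (σ ^ 2 / n) / (σ / √n) ^ 2 = 1 := by
    rw [div_pow, Real.sq_sqrt hn0.le]
    field_simp
  simpa [Real.coe_toNNReal _ (by positivity : 0 ≤ σ ^ 2 / (n : ℝ))] using this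

lemma IsModel.charFun_fixedCenterLaw (h : IsModel σ n P X θhat) (hσ : 0 < σ) (hn : 1 ≤ n)
    (k : ℕ) (θ : EllTwo) [IsProbabilityMeasure (P θ)] (t : ℕ → ℝ) (s : ℝ) :
    charFun (fixedCenterLaw σ k n θ X (P θ) t) s =
      Complex.exp (logCharFun k (∑ i ∈ Finset.range k, ((θ i - t i) / (σ / √n)) ^ 2)
        (s / √(2 * k + 4 * ∑ i ∈ Finset.range k, ((θ i - t i) / (σ / √n)) ^ 2))) := by
  have hX := h.measurable_obs
  let q : ℕ → ℝ → ℝ := fun i z => z ^ 2 - 1 + 2 * ((θ i - t i) / (σ / √n)) * z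
  let Y : ℕ → Ω → ℝ := fun i ω => q i ((X i ω - θ i) / (σ / √n))
  have hq : ∀ i, Measurable (q i) := fun i => by fun_prop
  have hY : ∀ i, Measurable (Y i) := fun i => (hq i).comp (by fun_prop)
  have hindep : iIndepFun Y (P θ) :=
    (h.indep_obs θ).comp (fun i x => q i ((x - θ i) / (σ / √n)))
      fun i => (hq i).comp (by fun_prop)
  have hlaw : ∀ i, (P θ).map (Y i) = (gaussianReal 0 1).map (q i) := fun i => by
    rw [← h.map_standardize_obs hσ hn θ i, Measure.map_map (hq i) (by fun_prop)]
    rfl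
  simp_rw [fixedCenterLaw, standardized_eq hσ hn]
  rw [charFun_map_mul_comp (f := fun ω => ∑ i ∈ Finset.range k, Y i ω)
      (Finset.measurable_fun_sum _ fun i _ => hY i).aemeasurable,
    (hindep.restrict _).charFun_map_fun_finsetSum_eq_prod fun i _ => (hY i).aemeasurable,
    Finset.prod_apply, ← prod_exp_logCharFun, div_eq_inv_mul s]
  refine Finset.prod_congr rfl fun i _ => ?_
  rw [hlaw, charFun_map_gaussianReal_quadratic]

lemma IsModel.condDistrib_stat_ae_eq (h : IsModel σ n P X θhat) (k : ℕ) (θ : EllTwo)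
    [IsProbabilityMeasure (P θ)] :
    ∀ᵐ ω ∂(P θ), condDistrib (stat σ k n θ X θhat) θhat (P θ) (θhat ω) =
      fixedCenterLaw σ k n θ X (P θ) (θhat ω) :=
  (h.indep_init θ).condDistrib_ae_eq_map (g := fun p => standardized σ k n (fun i => θ i) p.2 p.1)
    h.measurable_init h.measurable_pi_obs
    (measurable_standardized σ k n _ measurable_snd measurable_fst)

/-- Lévy's continuity theorem followed by Pólya's theorem, the normal law having no atoms. -/
lemma tendsto_kolmogorovToNormal {ν : ℕ → Measure ℝ} [∀ n, IsProbabilityMeasure (ν n)]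
    (h : ∀ s, Tendsto (fun n => charFun (ν n) s) atTop (𝓝 (Complex.exp (-(s ^ 2 / 2))))) :
    Tendsto (fun n => kolmogorovToNormal (ν n)) atTop (𝓝 0) := by
  let μ : ℕ → ProbabilityMeasure ℝ := fun n => ⟨ν n, inferInstance⟩
  let γ : ProbabilityMeasure ℝ := ⟨gaussianReal 0 1, inferInstance⟩
  have : NullSingletonClass (γ : Measure ℝ) := nullSingletonClass_gaussianReal one_ne_zero
  have hweak : Tendsto μ atTop (𝓝 γ) := by
    refine ProbabilityMeasure.tendsto_iff_tendsto_charFun.2 fun s => ?_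
    have e : charFun (γ : Measure ℝ) s = Complex.exp (-(s ^ 2 / 2)) := by
      simp [γ, charFun_gaussianReal]
    rw [e]
    exact h s
  rw [ENNReal.tendsto_nhds_zero]
  intro ε hε
  obtain ⟨r, hr0, hrε⟩ := ENNReal.lt_iff_exists_real_btwn.1 hε
  have hr : 0 < r := ENNReal.ofReal_pos.1 hrε.1
  filter_upwards [ProbabilityMeasure.eventually_forall_abs_real_Iic_sub_cdf_le hweak hr] with n hn
  exact iSup_le fun x => (ENNReal.ofReal_le_ofReal (hn x)).trans hrε.2.le

end GaussianSequence

/-! ### The uniform limit theorem -/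

/-- First conjunct: the conditional Kolmogorov distance given the initial estimator tends to zero
uniformly in `θ ∈ ℓ₂`, up to null sets. Second and third conjuncts: the fixed-center laws are
versions of the conditional laws given the initial estimator, and for them the convergence is also
uniform in the value `t` of the initial estimator, without exceptional sets. -/
theorem theorem3p1 (σ : ℝ) (hσ : 0 < σ) (k : ℕ → ℕ) (hk : Tendsto k atTop atTop)
    {Ω : ℕ → Type*} [∀ n, MeasurableSpace (Ω n)]
    (P : ∀ n, GaussianSequence.EllTwo → Measure (Ω n)) [∀ n θ, IsProbabilityMeasure (P n θ)]
    (X : ∀ n, ℕ → Ω n → ℝ) (θhat : ∀ n, Ω n → ℕ → ℝ)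
    (hmodel : ∀ n, 1 ≤ n → GaussianSequence.IsModel σ n (P n) (X n) (θhat n)) :
    Tendsto (fun n => ⨆ θ : GaussianSequence.EllTwo,
        essSup (fun ω => GaussianSequence.kolmogorovToNormal
          (condDistrib (GaussianSequence.stat σ (k n) n θ (X n) (θhat n)) (θhat n) (P n θ)
            (θhat n ω))) (P n θ)) atTop (𝓝 0) ∧
    (∀ n, 1 ≤ n → ∀ θ : GaussianSequence.EllTwo, ∀ᵐ ω ∂(P n θ),
        condDistrib (GaussianSequence.stat σ (k n) n θ (X n) (θhat n)) (θhat n) (P n θ)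
          (θhat n ω) =
        GaussianSequence.fixedCenterLaw σ (k n) n θ (X n) (P n θ) (θhat n ω)) ∧
    Tendsto (fun n => ⨆ θ : GaussianSequence.EllTwo, ⨆ t : ℕ → ℝ,
        GaussianSequence.kolmogorovToNormal
          (GaussianSequence.fixedCenterLaw σ (k n) n θ (X n) (P n θ) t)) atTop (𝓝 0) := by
  have hversion : ∀ n, 1 ≤ n → ∀ θ : GaussianSequence.EllTwo, ∀ᵐ ω ∂(P n θ),
      condDistrib (GaussianSequence.stat σ (k n) n θ (X n) (θhat n)) (θhat n) (P n θ)
        (θhat n ω) =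
      GaussianSequence.fixedCenterLaw σ (k n) n θ (X n) (P n θ) (θhat n ω) :=
    fun n hn θ => (hmodel n hn).condDistrib_stat_ae_eq (k n) θ
  have hfixed : Tendsto (fun n => ⨆ θ : GaussianSequence.EllTwo, ⨆ t : ℕ → ℝ,
      GaussianSequence.kolmogorovToNormal
        (GaussianSequence.fixedCenterLaw σ (k n) n θ (X n) (P n θ) t)) atTop (𝓝 0) := by
    -- The model is only assumed for `n ≥ 1`, hence the shift; the two suprema are then merged into
    -- one over pairs `(θ, t)`.
    rw [← tendsto_add_atTop_iff_nat 1]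
    refine (ENNReal.tendsto_iSup_zero_of_forall_selection fun p => ?_).congr fun n =>
      iSup_prod (f := fun p : GaussianSequence.EllTwo × (ℕ → ℝ) =>
        GaussianSequence.kolmogorovToNormal
          (GaussianSequence.fixedCenterLaw σ (k (n + 1)) (n + 1) p.1 (X (n + 1))
            (P (n + 1) p.1) p.2))
    have hm := fun n => hmodel (n + 1) n.succ_pos
    have := fun n => (hm n).isProbabilityMeasure_fixedCenterLaw (k (n + 1)) (p n).1 (p n).2
    refine GaussianSequence.tendsto_kolmogorovToNormal fun s => ?_
    simp_rw [(hm _).charFun_fixedCenterLaw hσ (Nat.succ_pos _)]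
    exact GaussianSequence.tendsto_exp_logCharFun
      (tendsto_natCast_atTop_atTop.comp (hk.comp (tendsto_add_atTop_nat 1)))
      (fun n => Finset.sum_nonneg fun i _ => sq_nonneg _) s
  refine ⟨tendsto_of_tendsto_of_tendsto_of_le_of_le' tendsto_const_nhds hfixed
    (.of_forall fun _ => zero_le) ?_, hversion, hfixed⟩
  filter_upwards [eventually_ge_atTop 1] with n hn
  -- Almost surely the conditional law is a fixed-center law, so the supremum over `t` dominates the
  -- essential supremum.
  refine iSup_mono fun θ => essSup_le_of_ae_le _ ?_
  filter_upwards [hversion n hn θ] with ω hω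
  rw [hω]
  exact le_iSup (fun t => GaussianSequence.kolmogorovToNormal
    (GaussianSequence.fixedCenterLaw σ (k n) n θ (X n) (P n θ) t)) (θhat n ω)
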